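/- Let $n \ge 2$ and $[n] = \{0, \dots, n-1\}$. Given a list $x = (x_0, \dots, x_{n-1})$ of elements of a totally ordered set, a single step of the \emph{harmonic sorter} picks, independently of all other steps, an unordered pair $\{i,j\} \subseteq [n]$, $i \ne j$, with probability $$\frac{1/|j-i|}{\sum_{0 \le k < \ell \le n-1} 1/|\ell-k|},$$ and sorts the entries at the positions $i<j$: they are swapped if the entry at position $i$ is larger than the entry at position $j$, and nothing is done otherwise. Let $\tau(x) \in \{0,1,2,\dots\} \cup \{\infty\}$ be the number of steps (comparisons) until the list, started from $x$, is first in non-decreasing order. Theorem. The harmonic sorter requires order $n (\log n)^2$ comparisons to sort a length-$n$ list in the worst case, both in expectation and with polynomially small failure probability. That is: 1. There is a constant $K > 0$ such that for every $n \ge 2$ and every length-$n$ list $x$ over any totally ordered set (repeated entries allowed), $\mathbb{E}[\tau(x)] \le K n (\log n)^2$. 2. For every $A > 0$ there is a constant $K > 0$ such that for every $n \ge 2$ and every such length-$n$ list $x$, $\mathbb{P}(\tau(x) > K n (\log n)^2) \le n^{-A}$. 3. There are a constant $c > 0$ and, for every $n$, a permutation $x^{(n)}$ of $[n]$ such that $\mathbb{E}[\tau(x^{(n)})]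 \ge c\, n (\log n)^2$ for all $n \ge 2$ and such that, for every $A > 0$, $\mathbb{P}(\tau(x^{(n)}) \le c\, n (\log n)^2) \le n^{-A}$ for all sufficiently large $n$. -/

import Mathlib

open MeasureTheory Filter
open scoped ENNReal NNReal

namespace RandomSorter

/-- The unordered pairs `{i, j}` of distinct positions in `[n] = {0, …, n - 1}`, each represented
by its increasing enumeration `(i, j)`, `i < j`. -/
abbrev Pair (n : ℕ) : Type := {p : Fin n × Fin n // p.1 < p.2}

/-- Sort the entries of the list `x` at the positions `i < j` of the pair `e = {i, j}`: swap them
if the entry at `i` is larger than the entry at `j`, and do nothing otherwise. -/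
def sortPair {n : ℕ} {α : Type*} [LinearOrder α] (e : Pair n) (x : Fin n → α) : Fin n → α :=
  if x e.1.2 < x e.1.1 then x ∘ Equiv.swap e.1.1 e.1.2 else x

/-- The list after `t` steps, started from `x`, when the pair sorted in step `s + 1` is `ω s`. -/
def state {n : ℕ} {α : Type*} [LinearOrder α] (x : Fin n → α) (ω : ℕ → Pair n) :
    ℕ → Fin n → α
  | 0 => x
  | t + 1 => sortPair (ω t) (state x ω t)

/-- The number of comparisons needed to sort `x`: the first time at which the list is sorted
(in non-decreasing order), and `⊤` if there is no such time. -/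
noncomputable def sortingTime {n : ℕ} {α : Type*} [LinearOrder α] (x : Fin n → α)
    (ω : ℕ → Pair n) : ℕ∞ :=
  ⨅ (t : ℕ) (_ : Monotone (state x ω t)), (t : ℕ∞)

/-- The law of a single pair in the randomised sorter driven by the (not identically zero)
weights `w`: the pair `e` has probability `w e / ∑ e', w e'`. -/
noncomputable def pairLaw {n : ℕ} (w : Pair n → ℝ≥0) (hw : w ≠ 0) : PMF (Pair n) :=
  PMF.normalize (fun e => (w e : ℝ≥0∞))
    (fun h => hw (funext fun e => by simpa using ENNReal.tsum_eq_zero.1 h e))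
    (by rw [tsum_fintype]; exact ENNReal.sum_ne_top.2 fun _ _ => ENNReal.coe_ne_top)

/-- The law of the sequence of pairs chosen by the randomised sorter with weights `w`: the pairs
are independent, each with law `pairLaw w hw`. -/
noncomputable def sorterLaw {n : ℕ} (w : Pair n → ℝ≥0) (hw : w ≠ 0) : Measure (ℕ → Pair n) :=
  Measure.infinitePi fun _ : ℕ => (pairLaw w hw).toMeasure

/-- The harmonic weights `w {i, j} = 1 / |j - i|`; as `i < j`, the subtraction of natural numbers
is `|j - i|`. -/
noncomputable def harmonicWeight (n : ℕ) (e : Pair n) : ℝ≥0 :=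
  1 / (((e.1.2 : ℕ) - (e.1.1 : ℕ) : ℕ) : ℝ≥0)

theorem harmonicWeight_ne_zero {n : ℕ} (hn : 2 ≤ n) : harmonicWeight n ≠ 0 := by
  intro h
  have h1 := congrFun h ⟨(⟨0, by omega⟩, ⟨1, by omega⟩), by simp [Fin.lt_def]⟩
  simp [harmonicWeight] at h1

/-- The law of the sequence of pairs chosen by the harmonic sorter. -/
noncomputable def harmonicLaw (n : ℕ) (hn : 2 ≤ n) : Measure (ℕ → Pair n) :=
  sorterLaw (harmonicWeight n) (harmonicWeight_ne_zero hn)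

end RandomSorter

/-!
The upper bound follows the potential `Ψ(y) = ∑_{i < j} (y i - y j)⁺` of the list `y` of ranks.
Since `(a - b)⁺ = max a b - b`, it equals `∑_{i < j} max (y i) (y j) - ∑ k, k * y k`. The first sum
is invariant under permutations, so sorting the positions `i < j` lowers `Ψ` by exactly
`(j - i) * (y i - y j)⁺`. The harmonic weight `1 / (j - i)` cancels the distance, hence one step
multiplies the expected potential by exactly `1 - 1 / W`, where `W ~ n log n` is the total weight.
As `Ψ ≤ n ^ 3`, and `Ψ ≥ 1` on unsorted lists, `O(W log n)` steps suffice.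

For the lower bound, start from `1, 0, 3, 2, …`. Each of the `n / 2` adjacent pairs `{2 k, 2 k + 1}`
has to be picked itself, and has probability `1 / W` per step, so sorting collects `n / 2` coupons
and needs about `W log n` steps. The coupon events are negatively correlated, which allows
their probabilities to be multiplied.
-/

namespace RandomSorter

section Sequences

variable {E : Type*}

/-- The sequence `e, ω 0, ω 1, …`, used to split a random sequence into its first term and an
independent remainder. -/
def seqCons (e : E) (ω : ℕ → E) : ℕ → E
  | 0 => e
  | k + 1 => ω k

variable [MeasurableSpace E]

theorem measurable_seqCons : Measurable fun q : E × (ℕ → E) => seqCons q.1 q.2 :=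
  measurable_pi_lambda _ fun
    | 0 => measurable_fst
    | k + 1 => (measurable_pi_apply k).comp measurable_snd

variable (μ : Measure E)

/-- The law of a sequence of independent samples from `μ`. -/
noncomputable abbrev iidLaw : Measure (ℕ → E) := Measure.infinitePi fun _ : ℕ => μ

variable [IsProbabilityMeasure μ]

theorem eq_iidLaw_of_forall_range {ν : Measure (ℕ → E)}
    (hν : ∀ (N : ℕ) (t : ℕ → Set E), (∀ k, MeasurableSet (t k)) →
      ν (Set.pi (Finset.range N) t) = ∏ k ∈ Finset.range N, μ (t k)) : ν = iidLaw μ := by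
  classical
  refine Measure.eq_infinitePi _ fun s t ht => ?_
  obtain ⟨N, hN⟩ := s.exists_nat_subset_range
  have hbox : Set.pi s t = Set.pi (Finset.range N) (s.piecewise t fun _ => Set.univ) := by
    ext ω
    simp only [Set.mem_pi, Finset.mem_coe, Finset.piecewise]
    refine ⟨fun h k _ => ?_, fun h k hk => by simpa [hk] using h k (hN hk)⟩
    split_ifs with hk
    exacts [h k hk, Set.mem_univ _]
  rw [hbox, hν N _ fun k => s.piecewise_cases t _ (MeasurableSet ·) (ht k) .univ,
    ← Finset.prod_subset hN fun k _ hk => by simp [hk]]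
  exact Finset.prod_congr rfl fun k hk => by rw [Finset.piecewise_eq_of_mem _ _ _ hk]

theorem map_seqCons_iidLaw :
    (μ.prod (iidLaw μ)).map (fun q => seqCons q.1 q.2) = iidLaw μ := by
  refine eq_iidLaw_of_forall_range μ fun N t ht => ?_
  rw [Measure.map_apply measurable_seqCons (.pi (Finset.countable_toSet _) fun k _ => ht k)]
  cases N with
  | zero => simp
  | succ N =>
    have hpre : (fun q : E × (ℕ → E) => seqCons q.1 q.2) ⁻¹' Set.pi (Finset.range (N + 1)) t =
        t 0 ×ˢ Set.pi (Finset.range N) fun k => t (k + 1) := by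
      ext ⟨e, ω⟩
      simp only [Set.mem_preimage, Set.mem_pi, Finset.mem_coe, Finset.mem_range,
        Nat.forall_lt_succ_left, Set.mem_prod]
      rfl
    rw [hpre, Measure.prod_prod, Measure.infinitePi_pi _ fun k _ => ht (k + 1), mul_comm,
      ← Finset.prod_range_succ' fun k => μ (t k)]

theorem lintegral_iidLaw_seqCons {f : (ℕ → E) → ℝ≥0∞} (hf : Measurable f) :
    ∫⁻ ω, f ω ∂iidLaw μ = ∫⁻ e, ∫⁻ ω, f (seqCons e ω) ∂iidLaw μ ∂μ := by
  conv_lhs => rw [← map_seqCons_iidLaw μ]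
  rw [lintegral_map hf measurable_seqCons]
  exact lintegral_prod _ (hf.comp measurable_seqCons).aemeasurable

theorem iidLaw_apply_seqCons {s : Set (ℕ → E)} (hs : MeasurableSet s) :
    iidLaw μ s = ∫⁻ e, iidLaw μ {ω | seqCons e ω ∈ s} ∂μ := by
  conv_lhs => rw [← map_seqCons_iidLaw μ]
  rw [Measure.map_apply measurable_seqCons hs, Measure.prod_apply (measurable_seqCons hs)]
  rfl

end Sequences

section CouponCollector

theorem prod_add_sum_mul_prod_erase_le {ι R : Type*} [DecidableEq ι] [CommSemiring R]
    [PartialOrder R] [CanonicallyOrderedAdd R] (s : Finset ι) (a b : ι → R) :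
    ∏ i ∈ s, a i + ∑ i ∈ s, b i * ∏ j ∈ s.erase i, a j ≤ ∏ i ∈ s, (a i + b i) := by
  induction s using Finset.induction_on with
  | empty => simp
  | insert k s hk ih =>
    have herase : ∀ i ∈ s, b i * ∏ j ∈ (insert k s).erase i, a j =
        a k * (b i * ∏ j ∈ s.erase i, a j) := fun i hi => by
      rw [Finset.erase_insert_of_ne (ne_of_mem_of_not_mem hi hk).symm,
        Finset.prod_insert (fun h => hk (Finset.mem_of_mem_erase h)), mul_left_comm]
    calc
      _ = a k * (∏ i ∈ s, a i + ∑ i ∈ s, b i * ∏ j ∈ s.erase i, a j) + b k * ∏ i ∈ s, a i := by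
        rw [Finset.prod_insert hk, Finset.sum_insert hk, Finset.erase_insert hk,
          Finset.sum_congr rfl herase, ← Finset.mul_sum]
        ring
      _ ≤ a k * ∏ i ∈ s, (a i + b i) + b k * ∏ i ∈ s, (a i + b i) := by
        gcongr
        exact le_self_add
      _ = ∏ i ∈ insert k s, (a i + b i) := by rw [Finset.prod_insert hk, add_mul]

variable {E : Type*} [MeasurableSpace E] [MeasurableSingletonClass E] (F : Finset E)

theorem measurableSet_forall_mem_exists_lt_eq (T : ℕ) :
    MeasurableSet {ω : ℕ → E | ∀ e ∈ F, ∃ s < T, ω s = e} := by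
  simp only [Set.ofPred_forall, Set.ofPred_exists, ← exists_prop]
  exact .biInter F.countable_toSet fun e _ => .biUnion (Set.to_countable {s | s < T})
    fun s _ => show MeasurableSet ((fun ω : ℕ → E => ω s) ⁻¹' {e}) from
      measurable_pi_apply s (measurableSet_singleton e)

variable (μ : Measure E) [IsProbabilityMeasure μ]

theorem lintegral_prod_erase_le [DecidableEq E] {a : E → ℝ≥0∞} (ha : ∀ e ∈ F, a e ≤ 1) :
    ∫⁻ e, ∏ j ∈ F.erase e, a j ∂μ ≤ ∏ e ∈ F, (a e + μ {e} * (1 - a e)) := by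
  have hmem : ∀ e ∈ F, (∏ j ∈ F.erase e, a j) * μ {e} =
      μ {e} * ∏ j ∈ F, a j + μ {e} * (1 - a e) * ∏ j ∈ F.erase e, a j := fun e he => by
    rw [← Finset.mul_prod_erase _ _ he, mul_assoc, ← mul_add, ← add_mul,
      add_tsub_cancel_of_le (ha e he), one_mul, mul_comm]
  have hcompl : ∫⁻ e in (F : Set E)ᶜ, ∏ j ∈ F.erase e, a j ∂μ = μ (F : Set E)ᶜ * ∏ j ∈ F, a j := by
    rw [setLIntegral_congr_fun (g := fun _ => ∏ j ∈ F, a j) F.measurableSet.compl fun e he => by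
      rw [Finset.erase_eq_of_notMem he], setLIntegral_const, mul_comm]
  calc
    _ = ∑ e ∈ F, (∏ j ∈ F.erase e, a j) * μ {e} + μ (F : Set E)ᶜ * ∏ j ∈ F, a j := by
      rw [← lintegral_add_compl _ F.measurableSet, lintegral_finset, hcompl]
    _ = (μ F + μ (F : Set E)ᶜ) * ∏ j ∈ F, a j +
        ∑ e ∈ F, μ {e} * (1 - a e) * ∏ j ∈ F.erase e, a j := by
      rw [Finset.sum_congr rfl hmem, Finset.sum_add_distrib, ← Finset.sum_mul,
        sum_measure_singleton]
      ring
    _ ≤ _ := by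
      rw [prob_add_prob_compl F.measurableSet, one_mul]
      exact prod_add_sum_mul_prod_erase_le F a fun e => μ {e} * (1 - a e)

theorem iidLaw_forall_mem_exists_lt_eq_le (T : ℕ) :
    iidLaw μ {ω | ∀ e ∈ F, ∃ s < T, ω s = e} ≤ ∏ e ∈ F, (1 - (1 - μ {e}) ^ T) := by
  classical
  induction T generalizing F with
  | zero =>
    rcases F.eq_empty_or_nonempty with rfl | ⟨e, he⟩
    · simp
    · have hempty : {ω : ℕ → E | ∀ e ∈ F, ∃ s < 0, ω s = e} = ∅ :=
        Set.eq_empty_of_forall_notMem fun ω h => by simpa using h e he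
      rw [hempty, measure_empty]
      exact zero_le
  | succ T ih =>
    have hfirst (e : E) : {ω : ℕ → E | seqCons e ω ∈ {ω | ∀ e ∈ F, ∃ s < T + 1, ω s = e}} =
        {ω | ∀ j ∈ F.erase e, ∃ s < T, ω s = j} := by
      ext ω
      simp only [Set.mem_ofPred_eq, Nat.exists_lt_succ_left, Finset.mem_erase, and_imp, seqCons]
      exact forall_congr' fun j => by tauto
    have hsucc (e : E) : 1 - (1 - μ {e}) ^ T + μ {e} * (1 - (1 - (1 - μ {e}) ^ T)) =
        1 - (1 - μ {e}) ^ (T + 1) := by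
      have hle : 1 - μ {e} ≤ 1 := tsub_le_self
      have hsub : μ {e} = 1 - (1 - μ {e}) :=
        (ENNReal.sub_sub_cancel ENNReal.one_ne_top prob_le_one).symm
      generalize 1 - μ {e} = q at hle hsub ⊢
      rw [hsub, ENNReal.sub_sub_cancel ENNReal.one_ne_top (pow_le_one₀ zero_le hle),
        ENNReal.sub_mul fun _ _ => by finiteness, one_mul, ← pow_succ',
        tsub_add_tsub_cancel (pow_le_one₀ zero_le hle) (pow_le_pow_right_of_le_one' hle T.le_succ)]
    rw [iidLaw_apply_seqCons μ (measurableSet_forall_mem_exists_lt_eq F (T + 1))]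
    simp only [hfirst, ← hsucc]
    exact (lintegral_mono fun e => ih (F.erase e)).trans
      (lintegral_prod_erase_le F μ fun e _ => tsub_le_self)

end CouponCollector

section Expectation

theorem toENNReal_eq_tsum (m : ℕ∞) :
    (m : ℝ≥0∞) = ∑' t : ℕ, {t : ℕ | (t : ℕ∞) < m}.indicator 1 t := by
  induction m using ENat.recTopCoe with
  | top => simp
  | coe m =>
    rw [tsum_eq_sum (s := Finset.range m) fun t ht => by simpa using ht,
      Finset.sum_congr rfl fun t ht => Set.indicator_of_mem (by simpa using ht) _]
    simp

variable {Ω : Type*} [MeasurableSpace Ω] {μ : Measure Ω} {τ : Ω → ℕ∞}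

theorem lintegral_toENNReal_eq_tsum (hτ : Measurable τ) :
    ∫⁻ ω, (τ ω : ℝ≥0∞) ∂μ = ∑' t : ℕ, μ {ω | (t : ℕ∞) < τ ω} := by
  have hmeas (t : ℕ) : MeasurableSet {ω | (t : ℕ∞) < τ ω} :=
    hτ (MeasurableSet.of_discrete (s := Set.Ioi (t : ℕ∞)))
  calc
    _ = ∫⁻ ω, ∑' t : ℕ, {ω | (t : ℕ∞) < τ ω}.indicator 1 ω ∂μ := by
      simp only [toENNReal_eq_tsum (τ _)]; rfl
    _ = ∑' t : ℕ, μ {ω | (t : ℕ∞) < τ ω} := by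
      rw [lintegral_tsum fun t => (measurable_one.indicator (hmeas t)).aemeasurable]
      simp only [lintegral_indicator_one (hmeas _)]

theorem lintegral_toENNReal_le_of_geometric [IsProbabilityMeasure μ] (hτ : Measurable τ)
    {C r : ℝ} (hC : 0 ≤ C) (hr0 : 0 ≤ r) (hr1 : r < 1)
    (htail : ∀ t : ℕ, μ {ω | (t : ℕ∞) < τ ω} ≤ ENNReal.ofReal (C * r ^ t)) (T : ℕ) :
    ∫⁻ ω, (τ ω : ℝ≥0∞) ∂μ ≤ ENNReal.ofReal (T + C * r ^ T * (1 - r)⁻¹) := by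
  have hhead : ∑ t ∈ Finset.range T, μ {ω | (t : ℕ∞) < τ ω} ≤ ENNReal.ofReal T :=
    (Finset.sum_le_card_nsmul _ _ 1 fun t _ => prob_le_one).trans (by simp)
  have hgeom : HasSum (fun t : ℕ => C * r ^ (t + T)) (C * r ^ T * (1 - r)⁻¹) := by
    simpa only [pow_add, mul_assoc, mul_comm (r ^ T)] using
      (hasSum_geometric_of_lt_one hr0 hr1).mul_left (C * r ^ T)
  calc
    _ = ∑ t ∈ Finset.range T, μ {ω | (t : ℕ∞) < τ ω} +
        ∑' t : ℕ, μ {ω | ((t + T : ℕ) : ℕ∞) < τ ω} := by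
      rw [lintegral_toENNReal_eq_tsum hτ, ENNReal.summable.sum_add_tsum_nat_add']
    _ ≤ ENNReal.ofReal T + ∑' t : ℕ, ENNReal.ofReal (C * r ^ (t + T)) :=
      add_le_add hhead (ENNReal.tsum_le_tsum fun t => htail (t + T))
    _ = _ := by
      rw [← ENNReal.ofReal_tsum_of_nonneg (fun t => by positivity) hgeom.summable, hgeom.tsum_eq,
        ENNReal.ofReal_add T.cast_nonneg
          (mul_nonneg (by positivity) (inv_nonneg.2 (sub_nonneg.2 hr1.le)))]

theorem toENNReal_le_ofReal_iff {m : ℕ∞} {b : ℝ} :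
    (m : ℝ≥0∞) ≤ ENNReal.ofReal b ↔ m ≤ (⌊b⌋₊ : ℕ∞) := by
  induction m using ENat.recTopCoe with
  | top => simp
  | coe m =>
    rcases eq_or_ne m 0 with rfl | hm
    · simp
    · rw [ENat.toENNReal_coe, ENNReal.natCast_le_ofReal hm, Nat.cast_le, Nat.le_floor_iff' hm]

theorem mul_one_sub_measure_le_lintegral [IsProbabilityMeasure μ] {f : Ω → ℝ≥0∞}
    (hf : Measurable f) (b : ℝ≥0∞) : b * (1 - μ {ω | f ω ≤ b}) ≤ ∫⁻ ω, f ω ∂μ := by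
  rw [← prob_compl_eq_one_sub (measurableSet_le hf measurable_const)]
  refine le_trans ?_ (mul_meas_ge_le_lintegral hf b)
  gcongr
  exact fun ω hω => le_of_lt (not_le.1 (Set.notMem_ofPred_iff.1 hω))

end Expectation

section Dynamics

variable {n : ℕ} {α β : Type*} [LinearOrder α] [LinearOrder β]

theorem sortPair_of_le {e : Pair n} {x : Fin n → α} (h : x e.1.1 ≤ x e.1.2) : sortPair e x = x :=
  if_neg h.not_gt

theorem sortPair_of_lt {e : Pair n} {x : Fin n → α} (h : x e.1.2 < x e.1.1) :
    sortPair e x = x ∘ Equiv.swap e.1.1 e.1.2 :=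
  if_pos h

theorem sortPair_comp {f : α → β} (hf : Monotone f) (e : Pair n) (x : Fin n → α) :
    sortPair e (f ∘ x) = f ∘ sortPair e x := by
  rcases le_or_gt (x e.1.1) (x e.1.2) with hle | hlt
  · rw [sortPair_of_le hle, sortPair_of_le (hf hle)]
  · rw [sortPair_of_lt hlt]
    rcases (hf hlt.le).eq_or_lt with heq | hlt'
    · rw [sortPair_of_le heq.ge]
      ext k
      simp only [Function.comp_apply] at heq ⊢
      rcases eq_or_ne k e.1.1 with rfl | h1
      · rw [Equiv.swap_apply_left, heq]
      rcases eq_or_ne k e.1.2 with rfl | h2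
      · rw [Equiv.swap_apply_right, heq]
      rw [Equiv.swap_apply_of_ne_of_ne h1 h2]
    · exact sortPair_of_lt hlt'

theorem range_sortPair (e : Pair n) (x : Fin n → α) : Set.range (sortPair e x) = Set.range x := by
  rcases le_or_gt (x e.1.1) (x e.1.2) with h | h
  · rw [sortPair_of_le h]
  · rw [sortPair_of_lt h, EquivLike.range_comp]

theorem sortPair_of_monotone {x : Fin n → α} (hx : Monotone x) (e : Pair n) : sortPair e x = x :=
  sortPair_of_le (hx e.2.le)

theorem state_comp {f : α → β} (hf : Monotone f) (x : Fin n → α) (ω : ℕ → Pair n) (t : ℕ) :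
    state (f ∘ x) ω t = f ∘ state x ω t := by
  induction t with
  | zero => rfl
  | succ t ih => rw [state, ih, sortPair_comp hf, state]

theorem range_state (x : Fin n → α) (ω : ℕ → Pair n) (t : ℕ) :
    Set.range (state x ω t) = Set.range x := by
  induction t with
  | zero => rfl
  | succ t ih => rw [state, range_sortPair, ih]

theorem state_seqCons_succ (x : Fin n → α) (e : Pair n) (ω : ℕ → Pair n) (t : ℕ) :
    state x (seqCons e ω) (t + 1) = state (sortPair e x) ω t := by
  induction t with
  | zero => rfl
  | succ t ih => rw [state, ih]; rfl

theorem state_eq_of_forall_lt {x : Fin n → α} {ω : ℕ → Pair n} {t : ℕ}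
    (h : ∀ s < t, sortPair (ω s) x = x) : state x ω t = x := by
  induction t with
  | zero => rfl
  | succ t ih => rw [state, ih fun s hs => h s (hs.trans t.lt_succ_self), h t t.lt_succ_self]

theorem monotone_state_of_le {x : Fin n → α} {ω : ℕ → Pair n} {s t : ℕ} (hst : s ≤ t)
    (h : Monotone (state x ω s)) : Monotone (state x ω t) := by
  induction t, hst using Nat.le_induction with
  | base => exact h
  | succ t _ ih => rwa [state, sortPair_of_monotone ih]

theorem sortingTime_le_iff {x : Fin n → α} {ω : ℕ → Pair n} {t : ℕ} :
    sortingTime x ω ≤ t ↔ Monotone (state x ω t) := by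
  refine ⟨fun h => ?_, fun h => iInf₂_le t h⟩
  have hlt : sortingTime x ω < (t + 1 : ℕ) := h.trans_lt (by exact_mod_cast t.lt_succ_self)
  simp only [sortingTime, iInf_lt_iff, Nat.cast_lt, Nat.lt_succ_iff] at hlt
  obtain ⟨s, hs, hst⟩ := hlt
  exact monotone_state_of_le hst hs

theorem lt_sortingTime_iff {x : Fin n → α} {ω : ℕ → Pair n} {t : ℕ} :
    (t : ℕ∞) < sortingTime x ω ↔ ¬Monotone (state x ω t) := by
  rw [← not_le, sortingTime_le_iff]

theorem sortingTime_comp {f : α → β} (hf : Monotone f) {x : Fin n → α}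
    (hfx : StrictMonoOn f (Set.range x)) (ω : ℕ → Pair n) :
    sortingTime (f ∘ x) ω = sortingTime x ω := by
  refine iInf_congr fun t => iInf_congr_Prop ?_ fun _ => rfl
  rw [state_comp hf]
  have hmem (k : Fin n) : state x ω t k ∈ Set.range x := range_state x ω t ▸ Set.mem_range_self k
  exact ⟨fun h i j hij => (hfx.le_iff_le (hmem i) (hmem j)).1 (h hij), hf.comp⟩

theorem measurable_comp_state {γ : Type*} [MeasurableSpace γ] (g : (Fin n → α) → γ)
    (x : Fin n → α) (t : ℕ) : Measurable fun ω : ℕ → Pair n => g (state x ω t) := by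
  induction t generalizing g with
  | zero => exact measurable_const (a := g x)
  | succ t ih =>
    have hpair : Measurable fun q : (ℕ → Pair n) × Pair n => g (sortPair q.2 (state x q.1 t)) :=
      measurable_from_prod_countable_left fun e => ih fun y => g (sortPair e y)
    exact hpair.comp (measurable_id.prodMk (measurable_pi_apply t))

theorem measurable_sortingTime (x : Fin n → α) : Measurable (sortingTime x) := by
  have hle (t : ℕ) : MeasurableSet {ω | sortingTime x ω ≤ t} := by
    simp only [sortingTime_le_iff]
    exact measurableSet_setOfPred.2 (measurable_comp_state Monotone x t)
  refine ENat.measurable_iff.2 fun t => ?_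
  have hpre : sortingTime x ⁻¹' {(t : ℕ∞)} =
      {ω | sortingTime x ω ≤ t} \ ⋃ s ∈ Finset.range t, {ω | sortingTime x ω ≤ s} := by
    ext ω
    simp only [Set.mem_preimage, Set.mem_singleton_iff, Set.mem_sdiff, Set.mem_ofPred_eq,
      Set.mem_iUnion, Finset.mem_range, not_exists, not_le]
    refine ⟨fun h => ⟨h.le, fun s hs => h ▸ by exact_mod_cast hs⟩, fun ⟨hτ, h⟩ => ?_⟩
    obtain ⟨m, hm⟩ := ENat.ne_top_iff_exists.1 (hτ.trans_lt (ENat.natCast_lt_top t)).ne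
    rw [← hm] at hτ h ⊢
    refine hτ.antisymm (not_lt.1 fun hlt => ?_)
    exact (h m (by exact_mod_cast hlt)).false
  rw [hpre]
  exact (hle t).diff (Finset.measurableSet_biUnion _ fun s _ => hle s)

theorem lintegral_state_le {μ : Measure (Pair n)} [IsProbabilityMeasure μ]
    {Φ : (Fin n → α) → ℝ≥0∞} {r : ℝ≥0∞} (hΦ : ∀ y, ∫⁻ e, Φ (sortPair e y) ∂μ ≤ r * Φ y)
    (x : Fin n → α) (t : ℕ) : ∫⁻ ω, Φ (state x ω t) ∂iidLaw μ ≤ r ^ t * Φ x := by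
  induction t generalizing x with
  | zero => simp [state]
  | succ t ih =>
    calc
      _ = ∫⁻ e, ∫⁻ ω, Φ (state (sortPair e x) ω t) ∂iidLaw μ ∂μ := by
        rw [lintegral_iidLaw_seqCons μ (measurable_comp_state Φ x (t + 1))]
        simp only [state_seqCons_succ]
      _ ≤ ∫⁻ e, r ^ t * Φ (sortPair e x) ∂μ := lintegral_mono fun e => ih (sortPair e x)
      _ = r ^ t * ∫⁻ e, Φ (sortPair e x) ∂μ := lintegral_const_mul _ .of_discrete
      _ ≤ r ^ (t + 1) * Φ x := by
        rw [pow_succ, mul_assoc]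
        gcongr
        exact hΦ x

end Dynamics

section Rank

variable {ι α : Type*} [Fintype ι] [LinearOrder α]

/-- The number of entries of the list `x` that are smaller than `v`; replacing the entries by their
ranks turns a list over any linear order into a list of natural numbers with the same
comparisons. -/
def rank (x : ι → α) (v : α) : ℕ :=
  (Finset.univ.filter fun k => x k < v).card

theorem rank_mono (x : ι → α) : Monotone (rank x) := fun _ _ hvw =>
  Finset.card_le_card (Finset.monotone_filter_right _ fun _ _ h => h.trans_le hvw)

theorem strictMonoOn_rank (x : ι → α) : StrictMonoOn (rank x) (Set.range x) := by
  rintro _ ⟨i, rfl⟩ w - hlt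
  have hsub : (Finset.univ.filter fun k => x k < x i) ⊆ Finset.univ.filter fun k => x k < w :=
    Finset.monotone_filter_right _ fun _ _ h => h.trans hlt
  exact Finset.card_lt_card ((Finset.ssubset_iff_of_subset hsub).2 ⟨i, by simpa using hlt, by simp⟩)

theorem rank_le_card (x : ι → α) (v : α) : rank x v ≤ Fintype.card ι :=
  Finset.card_filter_le _ _

end Rank

section Potential

variable {n : ℕ}

theorem sum_pair_eq_sum_sum_Iio {M : Type*} [AddCommMonoid M] (f : Fin n → Fin n → M) :
    ∑ e : Pair n, f e.1.1 e.1.2 = ∑ j, ∑ i ∈ Finset.Iio j, f i j := by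
  rw [← Finset.sum_subtype (Finset.univ.filter fun p : Fin n × Fin n => p.1 < p.2) (by simp)
    fun p => f p.1 p.2, Finset.sum_filter, Fintype.sum_prod_type_right]
  refine Finset.sum_congr rfl fun j _ => ?_
  rw [← Finset.sum_filter, Finset.filter_gt_eq_Iio]

theorem two_nsmul_sum_pair_add_sum_diag {M : Type*} [AddCommMonoid M] {f : Fin n → Fin n → M}
    (hf : ∀ i j, f i j = f j i) :
    2 • ∑ e : Pair n, f e.1.1 e.1.2 + ∑ j, f j j = ∑ j, ∑ i, f i j := by
  have habove : ∑ j, ∑ i ∈ Finset.Ioi j, f i j = ∑ e : Pair n, f e.1.1 e.1.2 := by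
    rw [sum_pair_eq_sum_sum_Iio, Finset.sum_comm' (t' := .univ) (s' := Finset.Iio) (by simp)]
    simp only [hf]
  simp only [fun j => Fintype.sum_eq_add_sum_compl j fun i => f i j, ← Finset.Ioi_disjUnion_Iio,
    Finset.sum_disjUnion, Finset.sum_add_distrib, habove, ← sum_pair_eq_sum_sum_Iio]
  rw [two_nsmul, add_comm]

theorem sum_pair_max_comp_perm (y : Fin n → ℕ) (σ : Equiv.Perm (Fin n)) :
    ∑ e : Pair n, max (y (σ e.1.1)) (y (σ e.1.2)) = ∑ e : Pair n, max (y e.1.1) (y e.1.2) := by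
  have hsum : ∑ j, ∑ i, max (y (σ i)) (y (σ j)) = ∑ j, ∑ i, max (y i) (y j) := by
    rw [← Equiv.sum_comp σ fun j => ∑ i, max (y i) (y j)]
    exact Finset.sum_congr rfl fun j _ => Equiv.sum_comp σ fun i => max (y i) (y (σ j))
  rw [← two_nsmul_sum_pair_add_sum_diag fun i j => max_comm (y (σ i)) (y (σ j)),
    ← two_nsmul_sum_pair_add_sum_diag fun i j => max_comm (y i) (y j)] at hsum
  simp only [max_self, Equiv.sum_comp σ y, smul_eq_mul] at hsum
  lia

/-- The total height `∑_{i < j} (y i - y j)⁺` of the inversions of a list of natural numbers (the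
truncated subtraction is the positive part), the potential function of the upper bound. -/
def inversionSum (y : Fin n → ℕ) : ℕ :=
  ∑ e : Pair n, (y e.1.1 - y e.1.2)

theorem inversionSum_add_sum_mul (y : Fin n → ℕ) :
    inversionSum y + ∑ k : Fin n, (k : ℕ) * y k = ∑ e : Pair n, max (y e.1.1) (y e.1.2) := by
  have hsnd : ∑ e : Pair n, y e.1.2 = ∑ k : Fin n, (k : ℕ) * y k := by
    simp [sum_pair_eq_sum_sum_Iio fun _ j => y j]
  simp only [inversionSum, ← hsnd, ← Finset.sum_add_distrib, tsub_add_eq_max]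

theorem inversionSum_sortPair_add (e : Pair n) (y : Fin n → ℕ) :
    inversionSum (sortPair e y) + (e.1.2 - e.1.1 : ℕ) * (y e.1.1 - y e.1.2) = inversionSum y := by
  rcases le_or_gt (y e.1.1) (y e.1.2) with hle | hlt
  · rw [sortPair_of_le hle, Nat.sub_eq_zero_of_le hle, mul_zero, add_zero]
  · rw [sortPair_of_lt hlt]
    set σ := Equiv.swap e.1.1 e.1.2
    have hmoment : ∑ k : Fin n, ((k : ℤ) * y (σ k) - k * y k) =
        (e.1.2 - e.1.1 : ℤ) * (y e.1.1 - y e.1.2) := by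
      rw [Fintype.sum_eq_add e.1.1 e.1.2 e.2.ne fun k hk => by
        rw [Equiv.swap_apply_of_ne_of_ne hk.1 hk.2, sub_self],
        Equiv.swap_apply_left, Equiv.swap_apply_right]
      ring
    have hmax := sum_pair_max_comp_perm y σ
    have hσ := inversionSum_add_sum_mul (y ∘ σ)
    have hy := inversionSum_add_sum_mul y
    simp only [Function.comp_apply, hmax, ← hy] at hσ
    rw [Finset.sum_sub_distrib] at hmoment
    have hij : (e.1.1 : ℕ) ≤ e.1.2 := e.2.le
    zify [hlt.le, hij] at hσ ⊢
    linarith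

theorem inversionSum_pos_of_not_monotone {y : Fin n → ℕ} (hy : ¬Monotone y) :
    1 ≤ inversionSum y := by
  simp only [Monotone, not_forall, not_le] at hy
  obtain ⟨i, j, hij, hlt⟩ := hy
  have hne : i ≠ j := by rintro rfl; exact hlt.false
  calc
    1 ≤ y i - y j := Nat.sub_pos_of_lt hlt
    _ ≤ inversionSum y := Finset.single_le_sum (f := fun e : Pair n => y e.1.1 - y e.1.2)
        (fun _ _ => Nat.zero_le _) (Finset.mem_univ ⟨(i, j), hij.lt_of_ne hne⟩)

theorem inversionSum_le_pow_three {y : Fin n → ℕ} (hy : ∀ k, y k ≤ n) : inversionSum y ≤ n ^ 3 := by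
  have hcard : Fintype.card (Pair n) ≤ n ^ 2 :=
    (Fintype.card_subtype_le _).trans_eq (by simp [sq])
  calc
    inversionSum y ≤ Fintype.card (Pair n) • n :=
      Finset.sum_le_card_nsmul _ _ _ fun e _ => (Nat.sub_le _ _).trans (hy e.1.1)
    _ ≤ n ^ 2 * n := Nat.mul_le_mul_right n hcard
    _ = n ^ 3 := (pow_succ n 2).symm

end Potential

section HarmonicWeights

variable {n : ℕ}

theorem coe_harmonicWeight (e : Pair n) :
    (harmonicWeight n e : ℝ) = ((e.1.2 : ℝ) - (e.1.1 : ℝ))⁻¹ := by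
  have hle : (e.1.1 : ℕ) ≤ e.1.2 := e.2.le
  simp [harmonicWeight, hle]

theorem harmonicWeight_mul_sub (e : Pair n) :
    (harmonicWeight n e : ℝ) * ((e.1.2 - e.1.1 : ℕ) : ℝ) = 1 := by
  have hlt : (e.1.1 : ℕ) < e.1.2 := e.2
  rw [coe_harmonicWeight, Nat.cast_sub hlt.le]
  exact inv_mul_cancel₀ (sub_ne_zero.2 (by exact_mod_cast hlt.ne'))

/-- The normalising constant `∑_{i < j} 1 / (j - i)` of the harmonic sorter. -/
noncomputable def totalWeight (n : ℕ) : ℝ :=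
  ∑ e : Pair n, (harmonicWeight n e : ℝ)

theorem one_le_totalWeight (hn : 2 ≤ n) : 1 ≤ totalWeight n := by
  have h := Finset.single_le_sum (s := Finset.univ)
    (f := fun e : Pair n => (harmonicWeight n e : ℝ)) (fun _ _ => NNReal.coe_nonneg _)
    (Finset.mem_univ ⟨(⟨0, by lia⟩, ⟨1, by lia⟩), by simp [Fin.lt_def]⟩)
  simpa [coe_harmonicWeight, totalWeight] using h

theorem totalWeight_eq_sum_harmonic (n : ℕ) :
    totalWeight n = ∑ m ∈ Finset.range n, (harmonic m : ℝ) := by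
  simp only [totalWeight, coe_harmonicWeight]
  rw [sum_pair_eq_sum_sum_Iio fun i j : Fin n => ((j : ℝ) - (i : ℝ))⁻¹,
    ← Fin.sum_univ_eq_sum_range fun m => (harmonic m : ℝ)]
  refine Finset.sum_congr rfl fun j _ => ?_
  calc
    ∑ i ∈ Finset.Iio j, ((j : ℝ) - (i : ℝ))⁻¹ = ∑ i ∈ Finset.range j, ((j : ℝ) - (i : ℝ))⁻¹ := by
      rw [← Nat.Iio_eq_range, ← Fin.map_valEmbedding_Iio, Finset.sum_map]
      rfl
    _ = (harmonic j : ℝ) := by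
      rw [← Finset.sum_range_reflect, harmonic, Rat.cast_sum]
      refine Finset.sum_congr rfl fun i hi => ?_
      have hij : i + 1 ≤ j := Finset.mem_range.1 hi
      rw [Nat.sub_sub, Nat.cast_sub (by lia)]
      push_cast
      ring

theorem totalWeight_le (n : ℕ) : totalWeight n ≤ n * (1 + Real.log n) := by
  rw [totalWeight_eq_sum_harmonic]
  refine (Finset.sum_le_card_nsmul _ _ (1 + Real.log n) fun m hm => ?_).trans
    (by rw [Finset.card_range, nsmul_eq_mul])
  refine (harmonic_le_one_add_log m).trans ?_
  rcases Nat.eq_zero_or_pos m with rfl | hpos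
  · simpa using Real.log_natCast_nonneg n
  · gcongr
    exact (Finset.mem_range.1 hm).le

theorem le_totalWeight (n : ℕ) : n * Real.log n - n ≤ totalWeight n := by
  have hfactorial : Real.log n.factorial ≤ totalWeight n := by
    rw [totalWeight_eq_sum_harmonic, ← Finset.prod_range_add_one_eq_factorial, Nat.cast_prod,
      Real.log_prod fun m _ => by positivity]
    exact Finset.sum_le_sum fun m _ => log_add_one_le_harmonic m
  rcases n.eq_zero_or_pos with rfl | hpos
  · simpa using hfactorial
  have hexp := Real.log_le_log (by positivity)
    (Real.pow_div_factorial_le_exp (n : ℝ) n.cast_nonneg n)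
  rw [Real.log_exp, Real.log_div (by positivity) (by positivity), Real.log_pow] at hexp
  linarith

theorem pairLaw_harmonicWeight_apply (hn : 2 ≤ n) (e : Pair n) :
    pairLaw (harmonicWeight n) (harmonicWeight_ne_zero hn) e =
      ENNReal.ofReal (harmonicWeight n e / totalWeight n) := by
  have hW := one_le_totalWeight hn
  rw [pairLaw, PMF.normalize_apply, tsum_fintype, div_eq_mul_inv,
    ENNReal.ofReal_mul (NNReal.coe_nonneg _), ENNReal.ofReal_coe_nnreal,
    ENNReal.ofReal_inv_of_pos (by linarith), totalWeight,
    ENNReal.ofReal_sum_of_nonneg fun _ _ => NNReal.coe_nonneg _]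
  simp only [ENNReal.ofReal_coe_nnreal]

end HarmonicWeights

section Contraction

variable {n : ℕ} {α : Type*} [LinearOrder α]

instance isProbabilityMeasure_harmonicLaw (hn : 2 ≤ n) : IsProbabilityMeasure (harmonicLaw n hn) :=
  inferInstanceAs (IsProbabilityMeasure (iidLaw _))

theorem sum_harmonicWeight_mul_inversionSum (y : Fin n → ℕ) :
    ∑ e, (harmonicWeight n e : ℝ) * inversionSum (sortPair e y) =
      (totalWeight n - 1) * inversionSum y := by
  have hdrop (e : Pair n) : (harmonicWeight n e : ℝ) * inversionSum (sortPair e y) =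
      harmonicWeight n e * inversionSum y - (y e.1.1 - y e.1.2 : ℕ) := by
    rw [← inversionSum_sortPair_add e y, Nat.cast_add, Nat.cast_mul, mul_add, ← mul_assoc,
      harmonicWeight_mul_sub, one_mul, add_sub_cancel_right]
  rw [Finset.sum_congr rfl fun e _ => hdrop e, Finset.sum_sub_distrib, ← Finset.sum_mul,
    ← Nat.cast_sum, sub_one_mul]
  rfl

theorem lintegral_inversionSum_sortPair (hn : 2 ≤ n) (y : Fin n → ℕ) :
    ∫⁻ e, (inversionSum (sortPair e y) : ℝ≥0∞)
        ∂(pairLaw (harmonicWeight n) (harmonicWeight_ne_zero hn)).toMeasure =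
      ENNReal.ofReal (1 - (totalWeight n)⁻¹) * inversionSum y := by
  have hW := one_le_totalWeight hn
  have hterm (e : Pair n) : (inversionSum (sortPair e y) : ℝ≥0∞) *
      ENNReal.ofReal (harmonicWeight n e / totalWeight n) =
      ENNReal.ofReal ((harmonicWeight n e * inversionSum (sortPair e y)) / totalWeight n) := by
    rw [← ENNReal.ofReal_natCast, ← ENNReal.ofReal_mul (Nat.cast_nonneg _), mul_div_right_comm,
      mul_comm]
  simp only [lintegral_fintype, PMF.toMeasure_apply_singleton _ _ (MeasurableSet.singleton _),
    pairLaw_harmonicWeight_apply hn, hterm]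
  rw [← ENNReal.ofReal_sum_of_nonneg fun e _ => by positivity, ← Finset.sum_div,
    sum_harmonicWeight_mul_inversionSum, ← ENNReal.ofReal_natCast,
    ← ENNReal.ofReal_mul (sub_nonneg.2 (inv_le_one_of_one_le₀ hW))]
  congr 1
  field_simp

theorem harmonicLaw_lt_sortingTime_le (hn : 2 ≤ n) (x : Fin n → α) (t : ℕ) :
    harmonicLaw n hn {ω | (t : ℕ∞) < sortingTime x ω} ≤
      ENNReal.ofReal (n ^ 3 * (1 - (totalWeight n)⁻¹) ^ t) := by
  have hr : 0 ≤ 1 - (totalWeight n)⁻¹ :=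
    sub_nonneg.2 (inv_le_one_of_one_le₀ (one_le_totalWeight hn))
  set y := rank x ∘ x
  have hy : inversionSum y ≤ n ^ 3 :=
    inversionSum_le_pow_three fun k => (rank_le_card x (x k)).trans_eq (Fintype.card_fin n)
  calc
    _ = harmonicLaw n hn {ω | ¬Monotone (state y ω t)} := by
      simp only [← lt_sortingTime_iff, y, sortingTime_comp (rank_mono x) (strictMonoOn_rank x)]
    _ ≤ harmonicLaw n hn {ω | 1 ≤ (inversionSum (state y ω t) : ℝ≥0∞)} :=
      measure_mono fun ω hω => by exact_mod_cast inversionSum_pos_of_not_monotone hω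
    _ ≤ ∫⁻ ω, (inversionSum (state y ω t) : ℝ≥0∞) ∂harmonicLaw n hn := by
      simpa only [one_mul] using mul_meas_ge_le_lintegral
        (measurable_comp_state (fun y => (inversionSum y : ℝ≥0∞)) y t) 1
    _ ≤ ENNReal.ofReal (1 - (totalWeight n)⁻¹) ^ t * inversionSum y :=
      lintegral_state_le (fun y => (lintegral_inversionSum_sortPair hn y).le) y t
    _ ≤ ENNReal.ofReal (n ^ 3 * (1 - (totalWeight n)⁻¹) ^ t) := by
      rw [mul_comm, ENNReal.ofReal_mul (by positivity), ENNReal.ofReal_pow hr,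
        ← Nat.cast_pow, ENNReal.ofReal_natCast]
      gcongr

end Contraction

section UpperBounds

variable {n : ℕ} {α : Type*} [LinearOrder α]

theorem one_le_three_halves_mul_log (hn : 2 ≤ n) : 1 ≤ 3 / 2 * Real.log n := by
  have hlog : Real.log 2 ≤ Real.log n := Real.log_le_log (by norm_num) (by exact_mod_cast hn)
  linarith [Real.log_two_gt_d9]

theorem totalWeight_le_mul_log (hn : 2 ≤ n) : totalWeight n ≤ 5 / 2 * (n * Real.log n) := by
  have hlog := mul_le_mul_of_nonneg_left (one_le_three_halves_mul_log hn) n.cast_nonneg (α := ℝ)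
  linarith [totalWeight_le n]

theorem pow_three_mul_one_sub_inv_totalWeight_pow_le (hn : 2 ≤ n) {A : ℝ} {t : ℕ}
    (ht : (A + 3) * (totalWeight n * Real.log n) ≤ t) :
    (n : ℝ) ^ 3 * (1 - (totalWeight n)⁻¹) ^ t ≤ (n : ℝ) ^ (-A) := by
  have hn0 : (0 : ℝ) < n := by positivity
  have hW := one_le_totalWeight hn
  have hdecay : (1 - (totalWeight n)⁻¹) ^ t ≤ (n : ℝ) ^ (-(A + 3)) := calc
    _ ≤ Real.exp (-(totalWeight n)⁻¹) ^ t :=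
      pow_le_pow_left₀ (sub_nonneg.2 (inv_le_one_of_one_le₀ hW)) (Real.one_sub_le_exp_neg _) t
    _ = Real.exp (-(t / totalWeight n)) := by rw [← Real.exp_nat_mul]; ring_nf
    _ ≤ Real.exp (-((A + 3) * Real.log n)) := by
      gcongr
      rw [le_div_iff₀ (by positivity)]
      linarith
    _ = (n : ℝ) ^ (-(A + 3)) := by rw [Real.rpow_def_of_pos hn0]; ring_nf
  calc
    _ ≤ (n : ℝ) ^ 3 * (n : ℝ) ^ (-(A + 3)) := by gcongr
    _ = (n : ℝ) ^ (-A) := by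
      rw [← Real.rpow_natCast, ← Real.rpow_add hn0]
      norm_num

theorem one_le_mul_log_sq (hn : 2 ≤ n) : 1 ≤ 9 / 8 * (n * Real.log n ^ 2) := by
  have hlog := one_le_three_halves_mul_log hn
  have hn2 : (2 : ℝ) ≤ n := by exact_mod_cast hn
  nlinarith [mul_nonneg (sub_nonneg.2 hn2) (sq_nonneg (Real.log n))]

theorem totalWeight_mul_log_le (hn : 2 ≤ n) :
    totalWeight n * Real.log n ≤ 5 / 2 * (n * Real.log n ^ 2) := calc
  _ ≤ 5 / 2 * (n * Real.log n) * Real.log n := by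
    gcongr
    exact totalWeight_le_mul_log hn
  _ = _ := by ring

theorem lintegral_sortingTime_le (hn : 2 ≤ n) (x : Fin n → α) :
    ∫⁻ ω, (sortingTime x ω : ℝ≥0∞) ∂harmonicLaw n hn ≤
      ENNReal.ofReal (15 * (n * Real.log n ^ 2)) := by
  have hW := one_le_totalWeight hn
  have hWlog := totalWeight_mul_log_le hn
  set T := ⌈3 * (totalWeight n * Real.log n)⌉₊
  have hT : T ≤ 3 * (totalWeight n * Real.log n) + 1 := (Nat.ceil_lt_add_one (by positivity)).le
  have htail : (n : ℝ) ^ 3 * (1 - (totalWeight n)⁻¹) ^ T ≤ 1 := by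
    simpa using pow_three_mul_one_sub_inv_totalWeight_pow_le (A := 0) hn
      (by simpa using Nat.le_ceil (3 * (totalWeight n * Real.log n)))
  refine (lintegral_toENNReal_le_of_geometric (measurable_sortingTime x) (by positivity)
    (sub_nonneg.2 (inv_le_one_of_one_le₀ hW)) (sub_lt_self _ (by positivity))
    (harmonicLaw_lt_sortingTime_le hn x) T).trans (ENNReal.ofReal_le_ofReal ?_)
  rw [sub_sub_cancel, inv_inv]
  calc
    _ ≤ 3 * (totalWeight n * Real.log n) + 1 + 1 * totalWeight n := by gcongr
    _ ≤ 15 * (n * Real.log n ^ 2) := by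
      nlinarith [one_le_mul_log_sq hn, one_le_three_halves_mul_log hn]

theorem harmonicLaw_lt_sortingTime_le_rpow (hn : 2 ≤ n) (x : Fin n → α) {A : ℝ} (hA : 0 ≤ A) :
    harmonicLaw n hn {ω | ENNReal.ofReal (5 / 2 * (A + 5) * (n * Real.log n ^ 2)) <
      (sortingTime x ω : ℝ≥0∞)} ≤ ENNReal.ofReal ((n : ℝ) ^ (-A)) := by
  set B := 5 / 2 * (A + 5) * (n * Real.log n ^ 2)
  have hB : (A + 3) * (totalWeight n * Real.log n) ≤ ⌊B⌋₊ := by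
    have hWlog := mul_le_mul_of_nonneg_left (totalWeight_mul_log_le hn) (by linarith : 0 ≤ A + 3)
    have hsplit : B = (A + 3) * (5 / 2 * (n * Real.log n ^ 2)) + 5 * (n * Real.log n ^ 2) := by ring
    linarith [Nat.lt_floor_add_one B, one_le_mul_log_sq hn]
  calc
    _ = harmonicLaw n hn {ω | (⌊B⌋₊ : ℕ∞) < sortingTime x ω} := by
      simp only [← not_le, toENNReal_le_ofReal_iff]
    _ ≤ _ := (harmonicLaw_lt_sortingTime_le hn x ⌊B⌋₊).trans
      (ENNReal.ofReal_le_ofReal (pow_three_mul_one_sub_inv_totalWeight_pow_le hn hB))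

end UpperBounds

section PairFlip

variable {n : ℕ}

/-- The involution of `[n]` exchanging `2 k` and `2 k + 1` whenever both are positions, and fixing
the last position when `n` is odd. -/
def pairFlip (n : ℕ) (i : Fin n) : Fin n :=
  ⟨if (i : ℕ) % 2 = 1 then i - 1 else if (i : ℕ) + 1 < n then i + 1 else i, by split_ifs <;> lia⟩

theorem pairFlip_involutive (n : ℕ) : Function.Involutive (pairFlip n) := fun i => by
  ext
  simp only [pairFlip]
  grind

/-- The permutation `1, 0, 3, 2, 5, 4, …`, the hard instance of the lower bound. -/
def pairFlipPerm (n : ℕ) : Equiv.Perm (Fin n) :=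
  (pairFlip_involutive n).toPerm

/-- The adjacent pairs `{2 k, 2 k + 1}`; each of them is inverted in `pairFlipPerm n`. -/
def blockPairs (n : ℕ) : Finset (Pair n) :=
  Finset.univ.filter fun e => (e.1.1 : ℕ) % 2 = 0 ∧ (e.1.2 : ℕ) = e.1.1 + 1

theorem half_le_card_blockPairs (n : ℕ) : n / 2 ≤ (blockPairs n).card := by
  have hlt (k : Fin (n / 2)) : 2 * (k : ℕ) + 1 < n := by lia
  let block (k : Fin (n / 2)) : Pair n :=
    ⟨(⟨2 * k, (Nat.lt_succ_self _).trans (hlt k)⟩, ⟨2 * k + 1, hlt k⟩), Nat.lt_succ_self _⟩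
  simpa using Finset.card_le_card_of_injOn (s := Finset.univ) (t := blockPairs n) block
    (fun k _ => by simp [block, blockPairs]) fun k _ l _ hkl => by
      simpa [block, Fin.ext_iff] using hkl

theorem harmonicWeight_of_mem_blockPairs {e : Pair n} (he : e ∈ blockPairs n) :
    harmonicWeight n e = 1 := by
  obtain ⟨-, he⟩ := (Finset.mem_filter.1 he).2
  simp [harmonicWeight, he]

theorem lt_pairFlip_of_ne {e d : Pair n} (he : e ∈ blockPairs n) (hne : d ≠ e)
    (hlt : e.1.1 < pairFlip n d.1.1) : e.1.1 < pairFlip n d.1.2 := by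
  obtain ⟨heven, hsucc⟩ := (Finset.mem_filter.1 he).2
  have hne' : ¬((d.1.1 : ℕ) = e.1.1 ∧ (d.1.2 : ℕ) = e.1.2) := fun h =>
    hne (Subtype.ext (Prod.ext (Fin.ext h.1) (Fin.ext h.2)))
  have hd : (d.1.1 : ℕ) < d.1.2 := d.2
  simp only [pairFlip, Fin.lt_def] at hlt ⊢
  grind

theorem pairFlip_fst_of_mem_blockPairs {e : Pair n} (he : e ∈ blockPairs n) :
    pairFlip n e.1.1 = e.1.2 := by
  obtain ⟨heven, hsucc⟩ := (Finset.mem_filter.1 he).2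
  ext
  simp only [pairFlip]
  grind

-- Thresholding at `e.1.1` leaves `e` as the only inverted pair, so until `e` is sorted the
-- thresholded list does not move.
theorem exists_eq_of_monotone_state_pairFlipPerm {ω : ℕ → Pair n} {t : ℕ}
    (h : Monotone (state (pairFlipPerm n) ω t)) {e : Pair n} (he : e ∈ blockPairs n) :
    ∃ s < t, ω s = e := by
  set threshold : Fin n → Prop := fun v => e.1.1 < v
  have hthreshold : Monotone threshold := fun _ _ hvw hv => hv.trans_le hvw
  by_contra! hω
  have hfrozen : state (threshold ∘ pairFlipPerm n) ω t = threshold ∘ pairFlipPerm n :=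
    state_eq_of_forall_lt fun s hs => sortPair_of_le (lt_pairFlip_of_ne he (hω s hs))
  have hsorted : Monotone (threshold ∘ pairFlipPerm n) := by
    rw [← hfrozen, state_comp hthreshold]
    exact hthreshold.comp h
  have hfst : pairFlip n e.1.1 = e.1.2 := pairFlip_fst_of_mem_blockPairs he
  have hsnd : pairFlip n e.1.2 = e.1.1 := by rw [← hfst, pairFlip_involutive]
  have hlt : e.1.1 < pairFlip n e.1.2 :=
    hsorted e.2.le (show e.1.1 < pairFlip n e.1.1 from e.2.trans_eq hfst.symm)
  exact (hlt.trans_eq hsnd).false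

theorem harmonicLaw_sortingTime_pairFlipPerm_le (hn : 2 ≤ n) (T : ℕ) :
    harmonicLaw n hn {ω | sortingTime (pairFlipPerm n) ω ≤ T} ≤
      ENNReal.ofReal ((1 - (1 - (totalWeight n)⁻¹) ^ T) ^ (n / 2)) := by
  have hq : 0 ≤ 1 - (totalWeight n)⁻¹ :=
    sub_nonneg.2 (inv_le_one_of_one_le₀ (one_le_totalWeight hn))
  have hq1 : 1 - (totalWeight n)⁻¹ ≤ 1 :=
    sub_le_self _ (inv_nonneg.2 (zero_le_one.trans (one_le_totalWeight hn)))
  have hr : 0 ≤ 1 - (1 - (totalWeight n)⁻¹) ^ T := sub_nonneg.2 (pow_le_one₀ hq hq1)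
  set μ := (pairLaw (harmonicWeight n) (harmonicWeight_ne_zero hn)).toMeasure
  have hmass : ∀ e ∈ blockPairs n, 1 - (1 - μ {e}) ^ T =
      ENNReal.ofReal (1 - (1 - (totalWeight n)⁻¹) ^ T) := fun e he => by
    rw [PMF.toMeasure_apply_singleton _ _ (MeasurableSet.singleton _),
      pairLaw_harmonicWeight_apply hn, harmonicWeight_of_mem_blockPairs he, NNReal.coe_one,
      one_div, ← ENNReal.ofReal_one, ← ENNReal.ofReal_sub _ (by linarith), ← ENNReal.ofReal_pow hq,
      ← ENNReal.ofReal_sub _ (pow_nonneg hq T)]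
  calc
    _ ≤ iidLaw μ {ω | ∀ e ∈ blockPairs n, ∃ s < T, ω s = e} := measure_mono fun ω hω e he =>
      exists_eq_of_monotone_state_pairFlipPerm (sortingTime_le_iff.1 hω) he
    _ ≤ ∏ e ∈ blockPairs n, (1 - (1 - μ {e}) ^ T) := iidLaw_forall_mem_exists_lt_eq_le _ μ T
    _ = ENNReal.ofReal (1 - (1 - (totalWeight n)⁻¹) ^ T) ^ (blockPairs n).card := by
      rw [Finset.prod_congr rfl hmass, Finset.prod_const]
    _ ≤ ENNReal.ofReal (1 - (1 - (totalWeight n)⁻¹) ^ T) ^ (n / 2) :=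
      pow_le_pow_right_of_le_one' (ENNReal.ofReal_le_one.2 (sub_le_self _ (pow_nonneg hq T)))
        (half_le_card_blockPairs n)
    _ = _ := (ENNReal.ofReal_pow hr _).symm

end PairFlip

section LowerBounds

variable {n : ℕ}

theorem exp_neg_inv_sub_one_le {w : ℝ} (hw : 1 < w) : Real.exp (-(w - 1)⁻¹) ≤ 1 - w⁻¹ := by
  have hw1 : 0 < w - 1 := sub_pos.2 hw
  calc
    Real.exp (-(w - 1)⁻¹) = (Real.exp (w - 1)⁻¹)⁻¹ := Real.exp_neg _
    _ ≤ ((w - 1)⁻¹ + 1)⁻¹ := inv_anti₀ (by positivity) (Real.add_one_le_exp _)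
    _ = 1 - w⁻¹ := by field_simp; ring

theorem log_eight : Real.log 8 = 3 * Real.log 2 := by
  rw [show (8 : ℝ) = 2 ^ 3 by norm_num, Real.log_pow, Nat.cast_ofNat]

theorem two_le_log (hn : 8 ≤ n) : 2 ≤ Real.log n := by
  have hlog : Real.log 8 ≤ Real.log n := Real.log_le_log (by norm_num) (by exact_mod_cast hn)
  linarith [log_eight, Real.log_two_gt_d9]

theorem mul_log_div_four_le_totalWeight_sub_one (hn : 8 ≤ n) :
    n * Real.log n / 4 ≤ totalWeight n - 1 := by
  have hn8 : (8 : ℝ) ≤ n := by exact_mod_cast hn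
  have hlog : n * 2 ≤ n * Real.log n := by gcongr; exact two_le_log hn
  linarith [le_totalWeight n]

theorem inv_sqrt_le_one_sub_inv_totalWeight_pow (hn : 8 ≤ n) {T : ℕ}
    (hT : T ≤ 1 / 8 * (n * Real.log n ^ 2)) : (√n)⁻¹ ≤ (1 - (totalWeight n)⁻¹) ^ T := by
  have hlog := two_le_log hn
  have hWlower := mul_log_div_four_le_totalWeight_sub_one hn
  have hW : 0 < totalWeight n - 1 := lt_of_lt_of_le (by positivity) hWlower
  have hexponent : T * (totalWeight n - 1)⁻¹ ≤ Real.log n / 2 := by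
    rw [← div_eq_mul_inv, div_le_iff₀ hW]
    calc
      (T : ℝ) ≤ Real.log n / 2 * (n * Real.log n / 4) := hT.trans_eq (by ring)
      _ ≤ Real.log n / 2 * (totalWeight n - 1) := by gcongr
  calc
    (√n)⁻¹ = Real.exp (-(Real.log n / 2)) := by
      rw [← Real.log_sqrt n.cast_nonneg, Real.exp_neg, Real.exp_log (by positivity)]
    _ ≤ Real.exp (-(totalWeight n - 1)⁻¹) ^ T := by
      rw [← Real.exp_nat_mul, mul_neg]
      gcongr
    _ ≤ (1 - (totalWeight n)⁻¹) ^ T :=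
      pow_le_pow_left₀ (Real.exp_nonneg _) (exp_neg_inv_sub_one_le (sub_pos.1 hW)) T

theorem one_sub_pow_half_le_exp_neg_sqrt (hn : 2 ≤ n) {p : ℝ} (hp : (√n)⁻¹ ≤ p) (hp1 : p ≤ 1) :
    (1 - p) ^ (n / 2) ≤ Real.exp (-(√n / 3)) := by
  have hhalf : (n : ℝ) / 3 ≤ (n / 2 : ℕ) := by
    rw [div_le_iff₀ three_pos]
    exact_mod_cast (by lia : n ≤ n / 2 * 3)
  calc
    (1 - p) ^ (n / 2) ≤ Real.exp (-(√n)⁻¹) ^ (n / 2) :=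
      pow_le_pow_left₀ (sub_nonneg.2 hp1)
        ((sub_le_sub_left hp 1).trans (Real.one_sub_le_exp_neg _)) _
    _ ≤ Real.exp (-(n / 3 * (√n)⁻¹)) := by
      rw [← Real.exp_nat_mul, mul_neg]
      gcongr
    _ = Real.exp (-(√n / 3)) := by
      rw [div_mul_eq_mul_div, ← div_eq_mul_inv, Real.div_sqrt]

theorem harmonicLaw_sortingTime_pairFlipPerm_le_exp (hn : 8 ≤ n) {b : ℝ}
    (hb : b ≤ 1 / 8 * (n * Real.log n ^ 2)) :
    harmonicLaw n (by lia) {ω | (sortingTime (pairFlipPerm n) ω : ℝ≥0∞) ≤ ENNReal.ofReal b} ≤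
      ENNReal.ofReal (Real.exp (-(√n / 3))) := by
  have hn2 : 2 ≤ n := by lia
  have hW := one_le_totalWeight hn2
  have hT : (⌊b⌋₊ : ℝ) ≤ 1 / 8 * (n * Real.log n ^ 2) :=
    (Nat.cast_le.2 (Nat.floor_mono hb)).trans (Nat.floor_le (by positivity))
  simp only [toENNReal_le_ofReal_iff]
  refine (harmonicLaw_sortingTime_pairFlipPerm_le hn2 ⌊b⌋₊).trans (ENNReal.ofReal_le_ofReal ?_)
  exact one_sub_pow_half_le_exp_neg_sqrt hn2 (inv_sqrt_le_one_sub_inv_totalWeight_pow hn hT)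
    (pow_le_one₀ (sub_nonneg.2 (inv_le_one_of_one_le₀ hW)) (sub_le_self _ (by positivity)))

theorem eventually_exp_neg_sqrt_le_rpow (A : ℝ) :
    ∀ᶠ n : ℕ in atTop, Real.exp (-(√n / 3)) ≤ (n : ℝ) ^ (-A) := by
  have hsqrt : Tendsto (fun n : ℕ => √(n : ℝ)) atTop atTop :=
    Real.tendsto_sqrt_atTop.comp tendsto_natCast_atTop_atTop
  have hlittleO := (isLittleO_exp_neg_mul_rpow_atTop (a := 1 / 3) (by norm_num)
    (-(2 * A))).comp_tendsto hsqrt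
  filter_upwards [hlittleO.bound one_pos] with n hn
  rw [one_mul, Function.comp_apply, Function.comp_apply, Real.norm_of_nonneg (Real.exp_nonneg _),
    Real.norm_of_nonneg (by positivity)] at hn
  calc
    Real.exp (-(√n / 3)) = Real.exp (-(1 / 3) * √n) := by ring_nf
    _ ≤ √n ^ (-(2 * A)) := hn
    _ = (n : ℝ) ^ (-A) := by
      rw [Real.sqrt_eq_rpow, ← Real.rpow_mul n.cast_nonneg]
      ring_nf

theorem eventually_harmonicLaw_sortingTime_pairFlipPerm_le_rpow (A : ℝ) {c : ℝ} (hc : c ≤ 1 / 8) :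
    ∃ n₀ : ℕ, ∀ (n : ℕ) (hn : 2 ≤ n), n₀ ≤ n →
      harmonicLaw n hn {ω | (sortingTime (pairFlipPerm n) ω : ℝ≥0∞) ≤
        ENNReal.ofReal (c * (n * Real.log n ^ 2))} ≤ ENNReal.ofReal ((n : ℝ) ^ (-A)) := by
  obtain ⟨n₁, hn₁⟩ := eventually_atTop.1 (eventually_exp_neg_sqrt_le_rpow A)
  refine ⟨max 8 n₁, fun n _ hmax => ?_⟩
  exact (harmonicLaw_sortingTime_pairFlipPerm_le_exp (le_of_max_le_left hmax) (by gcongr)).trans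
    (ENNReal.ofReal_le_ofReal (hn₁ n (le_of_max_le_right hmax)))

theorem one_le_sortingTime_pairFlipPerm (hn : 2 ≤ n) (ω : ℕ → Pair n) :
    1 ≤ sortingTime (pairFlipPerm n) ω := by
  obtain ⟨e, he⟩ : (blockPairs n).Nonempty :=
    Finset.card_pos.1 ((Nat.div_pos hn two_pos).trans_le (half_le_card_blockPairs n))
  refine Order.one_le_iff_pos.2 (lt_sortingTime_iff (t := 0) |>.2 fun h => ?_)
  obtain ⟨s, hs, -⟩ := exists_eq_of_monotone_state_pairFlipPerm (ω := ω) (t := 0) h he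
  exact Nat.not_lt_zero s hs

theorem mul_log_sq_le_of_lt_eight (hn : n < 8) : n * Real.log n ^ 2 ≤ 32 := by
  rcases n.eq_zero_or_pos with rfl | hpos
  · norm_num
  have hn7 : (n : ℝ) ≤ 7 := by exact_mod_cast Nat.le_of_lt_succ hn
  have hlog : Real.log n ≤ 21 / 10 := by
    have hle : Real.log n ≤ Real.log 8 := Real.log_le_log (by positivity) (by linarith)
    linarith [log_eight, Real.log_two_lt_d9]
  calc
    n * Real.log n ^ 2 ≤ 7 * (21 / 10) ^ 2 := by gcongr
    _ ≤ 32 := by norm_num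

theorem le_lintegral_sortingTime_pairFlipPerm (hn : 2 ≤ n) :
    ENNReal.ofReal (1 / 32 * (n * Real.log n ^ 2)) ≤
      ∫⁻ ω, (sortingTime (pairFlipPerm n) ω : ℝ≥0∞) ∂harmonicLaw n hn := by
  rcases lt_or_ge n 8 with hlt | hge
  · calc
      _ ≤ (1 : ℝ≥0∞) := ENNReal.ofReal_le_one.2 (by linarith [mul_log_sq_le_of_lt_eight hlt])
      _ = ∫⁻ _, 1 ∂harmonicLaw n hn := by simp
      _ ≤ _ := lintegral_mono fun ω => by
        simpa using ENat.toENNReal_le.2 (one_le_sortingTime_pairFlipPerm hn ω)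
  · set b := 1 / 8 * (n * Real.log n ^ 2)
    have hexp : Real.exp (-(√n / 3)) ≤ 3 / 4 := by
      have hsqrt : 1 ≤ √n := Real.one_le_sqrt.2 (by exact_mod_cast (by lia : 1 ≤ n))
      calc
        Real.exp (-(√n / 3)) = (Real.exp (√n / 3))⁻¹ := Real.exp_neg _
        _ ≤ (4 / 3)⁻¹ := inv_anti₀ (by norm_num) (by linarith [Real.add_one_le_exp (√n / 3)])
        _ = 3 / 4 := by norm_num
    have hfast : harmonicLaw n hn {ω | (sortingTime (pairFlipPerm n) ω : ℝ≥0∞) ≤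
        ENNReal.ofReal b} ≤ ENNReal.ofReal (3 / 4) :=
      (harmonicLaw_sortingTime_pairFlipPerm_le_exp hge le_rfl).trans (ENNReal.ofReal_le_ofReal hexp)
    calc
      _ = ENNReal.ofReal b * (1 - ENNReal.ofReal (3 / 4)) := by
        rw [← ENNReal.ofReal_one, ← ENNReal.ofReal_sub _ (by norm_num),
          ← ENNReal.ofReal_mul (by positivity)]
        congr 1
        ring
      _ ≤ ENNReal.ofReal b * (1 - harmonicLaw n hn {ω |
          (sortingTime (pairFlipPerm n) ω : ℝ≥0∞) ≤ ENNReal.ofReal b}) := by gcongr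
      _ ≤ _ := mul_one_sub_measure_le_lintegral
        ((measurable_from_top (f := ENat.toENNReal)).comp (measurable_sortingTime _)) _

end LowerBounds

end RandomSorter

theorem mainTheorem2 :
    -- upper bound in expectation, for every list
    (∃ K : ℝ, 0 < K ∧ ∀ (n : ℕ) (hn : 2 ≤ n) (α : Type*) [LinearOrder α] (x : Fin n → α),
      ∫⁻ ω, (RandomSorter.sortingTime x ω : ℝ≥0∞) ∂(RandomSorter.harmonicLaw n hn)
        ≤ ENNReal.ofReal (K * (n * Real.log n ^ 2))) ∧
    -- upper bound with polynomially small failure probability, for every list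
    (∀ A : ℝ, 0 < A → ∃ K : ℝ, 0 < K ∧
      ∀ (n : ℕ) (hn : 2 ≤ n) (α : Type*) [LinearOrder α] (x : Fin n → α),
        RandomSorter.harmonicLaw n hn
            {ω | ENNReal.ofReal (K * (n * Real.log n ^ 2))
              < (RandomSorter.sortingTime x ω : ℝ≥0∞)}
          ≤ ENNReal.ofReal ((n : ℝ) ^ (-A))) ∧
    -- lower bounds, in both senses, for some permutation of each length
    (∃ c : ℝ, 0 < c ∧ ∃ x : (n : ℕ) → Equiv.Perm (Fin n),
      (∀ (n : ℕ) (hn : 2 ≤ n),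
        ENNReal.ofReal (c * (n * Real.log n ^ 2))
          ≤ ∫⁻ ω, (RandomSorter.sortingTime (x n) ω : ℝ≥0∞) ∂(RandomSorter.harmonicLaw n hn)) ∧
      (∀ A : ℝ, 0 < A → ∃ n₀ : ℕ, ∀ (n : ℕ) (hn : 2 ≤ n), n₀ ≤ n →
        RandomSorter.harmonicLaw n hn
            {ω | (RandomSorter.sortingTime (x n) ω : ℝ≥0∞)
              ≤ ENNReal.ofReal (c * (n * Real.log n ^ 2))}
          ≤ ENNReal.ofReal ((n : ℝ) ^ (-A)))) := by
  refine ⟨⟨15, by norm_num, fun n hn α _ x => ?_⟩,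
    fun A hA => ⟨5 / 2 * (A + 5), by positivity, fun n hn α _ x => ?_⟩,
    ⟨1 / 32, by norm_num, RandomSorter.pairFlipPerm, fun n hn => ?_, fun A _ => ?_⟩⟩
  · exact RandomSorter.lintegral_sortingTime_le hn x
  · exact RandomSorter.harmonicLaw_lt_sortingTime_le_rpow hn x hA.le
  · exact RandomSorter.le_lintegral_sortingTime_pairFlipPerm hn
  · exact RandomSorter.eventually_harmonicLaw_sortingTime_pairFlipPerm_le_rpow A (by norm_num)
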